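/- Let $\beta>1$ be a non-integer real number. Put $T_\beta(x)=\{\beta x\}$ and let $d_\beta(1)=0.t_1t_2t_3\ldots$, with $t_i=\lfloor \beta\, T_\beta^{i-1}(1)\rfloor$ for $i\ge 1$, be the Rényi $\beta$-expansion of $1$. Assume that $\beta$ is a Parry number, i.e. that $d_\beta(1)$ is finite (only finitely many $t_i$ are nonzero) or ultimately periodic. For $j\ge 0$ let $Q_j(X)=X^j-t_1X^{j-1}-\cdots-t_{j-1}X-t_j$ (so $Q_0=1$). The Parry polynomial of $\beta$ is $n_\beta^*=Q_m$ if $d_\beta(1)$ is finite with last nonzero digit $t_m$, and $n_\beta^*=Q_{m+q}-Q_m$ if $d_\beta(1)$ is not finite and is ultimately periodic with (minimal) preperiod length $m\geq 0$ and (minimal) period length $q\ge 1$. Let $d_P=\deg n_\beta^*$ and let $\mathrm{rp}(n_\beta^*)$ be the number of positive real roots of $n_\beta^*$, counted with multiplicities. For a polynomial $R(X)=a\prod_{j=1}^n(X-b_j)\in\mathbb{C}[X]$ of degree $n\ge 1$ with $R(0)\neq 0$ put $$R^{(r)}(X)=\prod_{j=1}^n\Bigl(X-\frac{b_j}{|b_j|}\Bigr),\qquad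 \mathrm{dis}(R)=\frac1n\cdot\frac1{2\pi}\int_0^{2\pi}\max\{\log|R^{(r)}(e^{i\theta})|,0\}\,d\theta ,$$ and let $k=\sum_{m\ge 0}\frac{(-1)^m}{(2m+1)^2}=0.9159\ldots$ be Catalan's constant. Then $$\left(\frac{\mathrm{rp}(n_\beta^*)}{d_P}\right)^2\le \frac{2\pi}{k}\,\mathrm{dis}(n_\beta^*).$$ -/

import Mathlib

namespace Parry

/-- The beta-transformation `x ↦ {β x}`. -/
noncomputable def betaTransform (β x : ℝ) : ℝ := Int.fract (β * x)

/-- The digits of the Rényi `β`-expansion of `1`: `digit β i = tᵢ = ⌊β T_β^{i-1}(1)⌋` for `i ≥ 1`,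
with the usual convention `t₀ = -1`. -/
noncomputable def digit (β : ℝ) : ℕ → ℤ
  | 0 => -1
  | i + 1 => ⌊β * (betaTransform β)^[i] 1⌋

/-- `d_β(1) = 0.t₁t₂t₃…` is finite, with all digits after the `m`-th equal to zero. -/
def EndsAt (β : ℝ) (m : ℕ) : Prop := ∀ i, m < i → digit β i = 0

/-- The digits `t_{m+1} t_{m+2} …` repeat with period `q ≥ 1`. -/
def PeriodicAfter (β : ℝ) (m q : ℕ) : Prop :=
  1 ≤ q ∧ ∀ i, m < i → digit β (i + q) = digit β i

/-- `d_β(1)` is finite. -/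
def FiniteExpansion (β : ℝ) : Prop := ∃ m, EndsAt β m

/-- `d_β(1)` is ultimately periodic. -/
def UltimatelyPeriodicExpansion (β : ℝ) : Prop := ∃ m q, PeriodicAfter β m q

/-- A Parry number: a non-integer real `β > 1` whose Rényi expansion of `1` is finite or
ultimately periodic. -/
def IsParryNumber (β : ℝ) : Prop :=
  1 < β ∧ (∀ n : ℤ, β ≠ n) ∧ (FiniteExpansion β ∨ UltimatelyPeriodicExpansion β)

/-- The length of a finite `d_β(1)`: the index of its last nonzero digit. -/
noncomputable def expansionLength (β : ℝ) : ℕ := sInf {m | EndsAt β m}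

/-- The (minimal) preperiod length of an ultimately periodic `d_β(1)`. -/
noncomputable def preperiodLength (β : ℝ) : ℕ := sInf {m | ∃ q, PeriodicAfter β m q}

/-- The (minimal) period length of an ultimately periodic `d_β(1)`. -/
noncomputable def periodLength (β : ℝ) : ℕ := sInf {q | PeriodicAfter β (preperiodLength β) q}

/-- `X^j - t₁ X^{j-1} - ⋯ - t_{j-1} X - t_j` (recall `t₀ = -1`). -/
noncomputable def truncPoly (β : ℝ) (j : ℕ) : Polynomial ℤ :=
  -∑ i ∈ Finset.range (j + 1), Polynomial.C (digit β i) * Polynomial.X ^ (j - i)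

open Classical in
/-- The Parry polynomial `n*_β`. If `d_β(1)` is finite of length `m` it is
`X^m - t₁ X^{m-1} - ⋯ - t_m`. Otherwise, with preperiod length `m` and period length `q`, it is
`(X^{m+q} - t₁ X^{m+q-1} - ⋯ - t_{m+q}) - (X^m - t₁ X^{m-1} - ⋯ - t_m)`. -/
noncomputable def parryPoly (β : ℝ) : Polynomial ℤ :=
  if FiniteExpansion β then truncPoly β (expansionLength β)
  else truncPoly β (preperiodLength β + periodLength β) - truncPoly β (preperiodLength β)

/-- The number of positive real roots, counted with multiplicities. -/
noncomputable def rp (R : Polynomial ℝ) : ℕ :=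
  Multiset.card (R.roots.filter (fun x => 0 < x))

/-- The radial operator: `a ∏ⱼ (X - bⱼ) ↦ ∏ⱼ (X - bⱼ / |bⱼ|)`, roots with multiplicities.
It is meant for polynomials with nonzero constant term. -/
noncomputable def radial (R : Polynomial ℂ) : Polynomial ℂ :=
  (R.roots.map (fun b => Polynomial.X - Polynomial.C (b / (‖b‖ : ℂ)))).prod

/-- `h̃(R) = (1/2π) ∫₀^{2π} Log⁺ |R^{(r)}(e^{iθ})| dθ`. -/
noncomputable def hTilde (R : Polynomial ℂ) : ℝ :=
  1 / (2 * Real.pi) * ∫ θ in (0 : ℝ)..(2 * Real.pi),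
    Real.posLog ‖(radial R).eval (Complex.exp (θ * Complex.I))‖

/-- `dis(R) = h̃(R) / deg R`. -/
noncomputable def dis (R : Polynomial ℂ) : ℝ := hTilde R / R.natDegree

/-- Catalan's constant `1 - 1/9 + 1/25 - ⋯ = 0.9159…` (an absolutely convergent series). -/
noncomputable def catalanConstant : ℝ := ∑' m : ℕ, (-1 : ℝ) ^ m / (2 * (m : ℝ) + 1) ^ 2

end Parry

open Real Metric

namespace Parry

/-! The bound is an Erdős–Turán type estimate for one ray. Let `r` of the at most `n` normalized
roots equal `1`, and write the radial polynomial on the unit circle, up to modulus, as `∏ (1 - w z)`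
with `‖w‖ ≤ 1`. Its logarithm `F` is holomorphic in the open disc with `F 0 = 0`, so `Re F` has mean
zero.

Pairing `Re F` with a kernel `k` gives `Re (ρ F' ρ)`. Each factor contributes at most `1/2` to this,
and each `w = 1` contributes `1/2 - A/2`, where `A = (1 + ρ)/(1 - ρ)`. Since `0 ≤ U - k ≤ (9/16) A²`
for `U = 2ρ/(1 - ρ)²`, the mean of `(U - k) Re F` gives `r A / 2 - n / 2 ≤ (9/16) A² h`, where `h`
is the mean of `log⁺` of the modulus (`count_one_le_circleAverage`).

Taking `A = 2n/r` yields `r² ≤ (9/2) n h` (`sq_count_one_le`). Finally `9/2 < 2π ≤ 2π/k` with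
Catalan's `k ≤ 1`, and positive real roots normalize to `1`. -/

/-! ### The kernel: reproducing formula and sharp range. -/

/-- On the unit circle this is `ρ ∂/∂ρ` of the Poisson kernel at `ρ z`. -/
noncomputable def poissonRadialDeriv (ρ : ℝ) (z : ℂ) : ℝ := 2 * ((ρ * z) / (1 - ρ * z) ^ 2).re

lemma one_sub_mul_ne_zero_of_norm_lt {u : ℂ} (hu : ‖u‖ < 1) : 1 - u ≠ 0 := by
  intro h
  rw [← sub_eq_zero.mp h] at hu
  simp at hu

lemma norm_ofReal_mul_lt_one {ρ : ℝ} (h0 : 0 < ρ) (h1 : ρ < 1) {z : ℂ} (hz : ‖z‖ ≤ 1) :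
    ‖(ρ : ℂ) * z‖ < 1 := by
  rw [norm_mul, Complex.norm_real, norm_of_nonneg h0.le]
  nlinarith

lemma differentiableOn_koebe {ρ : ℝ} (h0 : 0 < ρ) (h1 : ρ < 1) :
    DifferentiableOn ℂ (fun z : ℂ => (ρ * z) / (1 - ρ * z) ^ 2) (closedBall 0 1) := by
  intro z hz
  have hne : (1 - (ρ : ℂ) * z) ^ 2 ≠ 0 := pow_ne_zero _
    (one_sub_mul_ne_zero_of_norm_lt (norm_ofReal_mul_lt_one h0 h1 (by simpa using hz)))
  have hnum : DifferentiableAt ℂ (fun z : ℂ => (ρ : ℂ) * z) z := by fun_prop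
  have hden : DifferentiableAt ℂ (fun z : ℂ => (1 - (ρ : ℂ) * z) ^ 2) z := by fun_prop
  exact (hnum.div hden hne).differentiableWithinAt

/-- Cauchy's formula for the derivative in terms of the real part of the function. -/
lemma circleAverage_re_mul_poissonRadialDeriv {F : ℂ → ℂ} {R ρ : ℝ} (hR : 1 < R)
    (hF : DifferentiableOn ℂ F (ball 0 R)) (hF0 : F 0 = 0) (h0 : 0 < ρ) (h1 : ρ < 1) :
    circleAverage (fun z => (F z).re * poissonRadialDeriv ρ z) 0 1 = (ρ * deriv F ρ).re := by
  have hsub : closedBall (0 : ℂ) 1 ⊆ ball 0 R := closedBall_subset_ball hR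
  have hsph : sphere (0 : ℂ) 1 ⊆ closedBall 0 1 := sphere_subset_closedBall
  set K : ℂ → ℂ := fun z => (ρ * z) / (1 - ρ * z) ^ 2 with hK
  set G : ℂ → ℂ := fun z => z * (((z - ρ) ^ 2)⁻¹ * (ρ * F z)) with hG
  have hFK : DifferentiableOn ℂ (fun z => F z * K z) (closedBall 0 1) :=
    (hF.mono hsub).mul (differentiableOn_koebe h0 h1)
  have hne : ∀ z ∈ sphere (0 : ℂ) 1, z - ρ ≠ 0 := by
    intro z hz h
    rw [sub_eq_zero.mp h] at hz
    simp [abs_of_pos h0] at hz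
    linarith
  have hGc : ContinuousOn G (sphere 0 1) := by
    refine continuousOn_id.mul (ContinuousOn.mul (ContinuousOn.inv₀ (by fun_prop) ?_) ?_)
    · exact fun z hz => pow_ne_zero _ (hne z hz)
    · exact continuousOn_const.mul (hF.continuousOn.mono (hsph.trans hsub))
  have hi1 : CircleIntegrable (fun z => F z * K z) 0 1 :=
    (hFK.continuousOn.mono hsph).circleIntegrable zero_le_one
  have hi2 : CircleIntegrable G 0 1 := hGc.circleIntegrable zero_le_one
  -- The kernel is `K + conj K` on the circle. The `K` half is holomorphic and averages to its value
  -- at `0`; the conjugate half, rewritten with `conj z = z⁻¹`, is a Cauchy kernel for `F'`.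
  have hA1 : circleAverage (fun z => F z * K z) 0 1 = 0 := by
    have : DiffContOnCl ℂ (fun z => F z * K z) (ball 0 |1|) := by
      rw [abs_one]
      refine DifferentiableOn.diffContOnCl ?_
      rwa [closure_ball _ one_ne_zero]
    rw [this.circleAverage, hF0, zero_mul]
  have hA2 : circleAverage G 0 1 = ρ * deriv F ρ := by
    have hρ : (ρ : ℂ) ∈ ball (0 : ℂ) 1 := by simpa [abs_of_pos h0] using h1
    rw [circleAverage_eq_circleIntegral one_ne_zero]
    have hd : DifferentiableAt ℂ F ρ :=
      hF.differentiableAt (isOpen_ball.mem_nhds (hsub (ball_subset_closedBall hρ)))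
    rw [← deriv_const_mul _ hd,
      ← Complex.two_pi_I_inv_smul_circleIntegral_sub_sq_inv_smul_of_differentiable isOpen_ball hsub
        (hF.const_mul (ρ : ℂ)) hρ]
    congr 1
    refine circleIntegral.integral_congr zero_le_one fun z hz => ?_
    have hz0 : z ≠ 0 := ne_zero_of_mem_unit_sphere ⟨z, hz⟩
    simp only [hG, smul_eq_mul, sub_zero]
    field_simp
  have hpt : Set.EqOn (fun z => (F z).re * poissonRadialDeriv ρ z)
      (Complex.reCLM ∘ (fun z => F z * K z + G z)) (sphere 0 |1|) := by
    intro z hz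
    rw [abs_one] at hz
    have hz1 : ‖z‖ = 1 := by simpa using hz
    have hz0 : z ≠ 0 := by rintro rfl; simp at hz1
    have hconj : G z = F z * (starRingEnd ℂ) (K z) := by
      have hz' : (starRingEnd ℂ) z = z⁻¹ := by
        rw [Complex.inv_def, Complex.normSq_eq_norm_sq, hz1]; simp
      have h2 := hne z hz
      have h3 : 1 - (ρ : ℂ) * z⁻¹ ≠ 0 := by
        intro h
        apply h2
        field_simp at h
        linear_combination h
      simp only [hG, hK, map_div₀, map_mul, map_pow, map_sub, map_one, Complex.conj_ofReal, hz']
      have h4 : 1 - (ρ : ℂ) * z⁻¹ = (z - ρ) / z := by field_simp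
      rw [h4]
      field_simp
    simp only [Function.comp_apply, Complex.reCLM_apply, hconj, poissonRadialDeriv]
    rw [← mul_add, Complex.add_conj, Complex.re_mul_ofReal]
  rw [circleAverage_congr_sphere hpt, ContinuousLinearMap.circleAverage_comp_comm _ (f := fun z => F z * K z + G z)
      (hi1.add hi2),
    circleAverage_fun_add hi1 hi2, hA1, hA2, zero_add, Complex.reCLM_apply]

lemma poissonRadialDeriv_eq {ρ : ℝ} (h0 : 0 < ρ) (h1 : ρ < 1) {z : ℂ} (hz : ‖z‖ = 1) :
    poissonRadialDeriv ρ z =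
      (1 - ρ ^ 2) ^ 2 / (1 - 2 * ρ * z.re + ρ ^ 2) ^ 2
        - (1 + ρ ^ 2) / (1 - 2 * ρ * z.re + ρ ^ 2) := by
  have hsq : z.re ^ 2 + z.im ^ 2 = 1 := by
    have := Complex.sq_norm z
    rw [hz, Complex.normSq_apply] at this
    linarith
  have hre : z.re ≤ 1 := by nlinarith [sq_nonneg z.im]
  have hD : 0 < 1 - 2 * ρ * z.re + ρ ^ 2 := by nlinarith [sq_pos_of_pos (sub_pos.mpr h1)]
  have hn : Complex.normSq ((1 - (ρ : ℂ) * z) ^ 2) = (1 - 2 * ρ * z.re + ρ ^ 2) ^ 2 := by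
    rw [map_pow, Complex.normSq_apply]
    simp only [Complex.sub_re, Complex.one_re, Complex.re_ofReal_mul, Complex.sub_im,
      Complex.one_im, Complex.im_ofReal_mul]
    congr 1
    linear_combination ρ ^ 2 * hsq
  rw [poissonRadialDeriv, Complex.div_re, hn]
  simp only [pow_two (1 - (ρ : ℂ) * z), Complex.mul_re, Complex.mul_im, Complex.sub_re,
    Complex.one_re, Complex.sub_im, Complex.one_im, Complex.ofReal_re, Complex.ofReal_im]
  field_simp
  have him : z.im ^ 2 = 1 - z.re ^ 2 := by linarith
  ring_nf
  simp only [him]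
  ring

/-- In `y = 1/D` the kernel is a convex quadratic. Its maximum is at the endpoint `D = (1 - ρ)²`,
and completing the square bounds it below. The constant `9/16` is the limiting ratio as `ρ → 1`. -/
lemma poissonRadialDeriv_bounds {ρ : ℝ} (h0 : 0 < ρ) (h1 : ρ < 1) {z : ℂ} (hz : ‖z‖ = 1) :
    poissonRadialDeriv ρ z ≤ 2 * ρ / (1 - ρ) ^ 2 ∧
      2 * ρ / (1 - ρ) ^ 2 - 9 / 16 * ((1 + ρ) / (1 - ρ)) ^ 2 ≤ poissonRadialDeriv ρ z := by
  have hre : |z.re| ≤ 1 := hz ▸ Complex.abs_re_le_norm z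
  obtain ⟨hre1, hre2⟩ := abs_le.mp hre
  rw [poissonRadialDeriv_eq h0 h1 hz]
  set D := 1 - 2 * ρ * z.re + ρ ^ 2 with hD
  have hD1 : (1 - ρ) ^ 2 ≤ D := by nlinarith
  have hD2 : D ≤ (1 + ρ) ^ 2 := by nlinarith
  have hp : 0 < (1 - ρ) ^ 2 := by have := sub_pos.mpr h1; positivity
  have hDp : 0 < D := hp.trans_le hD1
  have h1' : (1 - ρ) ≠ 0 := (sub_pos.mpr h1).ne'
  have h2' : 1 + ρ ≠ 0 := by positivity
  have h3' : (1 - ρ ^ 2) ≠ 0 := by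
    rw [show 1 - ρ ^ 2 = (1 - ρ) * (1 + ρ) by ring]; exact mul_ne_zero h1' h2'
  constructor
  · have key : 2 * ρ / (1 - ρ) ^ 2 - ((1 - ρ ^ 2) ^ 2 / D ^ 2 - (1 + ρ ^ 2) / D)
        = (D - (1 - ρ) ^ 2) * (2 * ρ * D + (1 - ρ ^ 2) ^ 2) / ((1 - ρ) ^ 2 * D ^ 2) := by
      field_simp
      ring
    have : 0 ≤ (D - (1 - ρ) ^ 2) * (2 * ρ * D + (1 - ρ ^ 2) ^ 2) / ((1 - ρ) ^ 2 * D ^ 2) := by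
      have := sub_nonneg.mpr hD1
      positivity
    linarith
  · have key : (1 - ρ ^ 2) ^ 2 / D ^ 2 - (1 + ρ ^ 2) / D + (1 + ρ ^ 2) ^ 2 / (4 * (1 - ρ ^ 2) ^ 2)
        = ((1 - ρ ^ 2) / D - (1 + ρ ^ 2) / (2 * (1 - ρ ^ 2))) ^ 2 := by
      field_simp
      ring
    have key2 : 9 / 16 * ((1 + ρ) / (1 - ρ)) ^ 2 - 2 * ρ / (1 - ρ) ^ 2
        - (1 + ρ ^ 2) ^ 2 / (4 * (1 - ρ ^ 2) ^ 2)
        = (1 - ρ) ^ 2 * (5 * (1 + ρ) ^ 2 + 4 * ρ) / (16 * (1 - ρ ^ 2) ^ 2) := by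
      rw [show 1 - ρ ^ 2 = (1 - ρ) * (1 + ρ) by ring]
      field_simp
      ring
    have : 0 ≤ (1 - ρ) ^ 2 * (5 * (1 + ρ) ^ 2 + 4 * ρ) / (16 * (1 - ρ ^ 2) ^ 2) := by positivity
    nlinarith [sq_nonneg ((1 - ρ ^ 2) / D - (1 + ρ ^ 2) / (2 * (1 - ρ ^ 2)))]

/-! ### The logarithm of the product and its logarithmic derivative. -/

/-- `∏ (1 - w X)` over the multiset. -/
noncomputable def reciprocalProd (S : Multiset ℂ) : Polynomial ℂ :=
  (S.map fun w => 1 - Polynomial.C w * Polynomial.X).prod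

/-- A holomorphic logarithm of `z ↦ ∏ (1 - w s z)`. -/
noncomputable def logProd (S : Multiset ℂ) (s : ℝ) (z : ℂ) : ℂ :=
  (S.map fun w => Complex.log (1 - w * (s * z))).sum

lemma norm_mul_dilate_lt_one {s : ℝ} (hs : 0 < s) {w z : ℂ} (hw : ‖w‖ ≤ 1)
    (hz : z ∈ ball (0 : ℂ) s⁻¹) : ‖w * (s * z)‖ < 1 := by
  rw [mem_ball_zero_iff] at hz
  rw [norm_mul, norm_mul, Complex.norm_real, norm_of_nonneg hs.le]
  have : s * ‖z‖ < 1 := by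
    calc s * ‖z‖ < s * s⁻¹ := by gcongr
      _ = 1 := mul_inv_cancel₀ hs.ne'
  exact (mul_le_of_le_one_left (by positivity) hw).trans_lt this

lemma hasDerivAt_logProd {S : Multiset ℂ} (hS : ∀ w ∈ S, ‖w‖ ≤ 1) {s : ℝ} (hs : 0 < s) {z : ℂ}
    (hz : z ∈ ball (0 : ℂ) s⁻¹) :
    HasDerivAt (logProd S s) (S.map fun w => -(w * s) / (1 - w * (s * z))).sum z := by
  induction S using Multiset.induction with
  | empty =>
    have : logProd 0 s = fun _ => 0 := by funext; simp [logProd]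
    rw [this]
    exact hasDerivAt_const z (0 : ℂ)
  | cons w S ih =>
    have hw := norm_mul_dilate_lt_one hs (hS w (by simp)) hz
    have h1 : HasDerivAt (fun z : ℂ => 1 - w * (s * z)) (-(w * s)) z := by
      simpa using (((hasDerivAt_id z).const_mul (s : ℂ)).const_mul w).const_sub 1
    have h2 : 1 - w * (s * z) ∈ Complex.slitPlane := by
      refine Or.inl ?_
      have := (Complex.re_le_norm (w * (s * z))).trans_lt hw
      rw [Complex.sub_re, Complex.one_re]
      linarith
    have h3 := (h1.clog h2).add (ih fun w' hw' => hS w' (Multiset.mem_cons_of_mem hw'))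
    rw [Multiset.map_cons, Multiset.sum_cons]
    refine h3.congr_of_eventuallyEq (Filter.Eventually.of_forall fun y => ?_)
    simp [logProd]

lemma re_logProd {S : Multiset ℂ} (hS : ∀ w ∈ S, ‖w‖ ≤ 1) {s : ℝ} (hs : 0 < s) {z : ℂ}
    (hz : z ∈ ball (0 : ℂ) s⁻¹) :
    (logProd S s z).re = log ‖(reciprocalProd S).eval (s * z)‖ ∧
      (reciprocalProd S).eval (s * z) ≠ 0 := by
  induction S using Multiset.induction with
  | empty => simp [logProd, reciprocalProd]
  | cons w S ih =>
    have hw := one_sub_mul_ne_zero_of_norm_lt (norm_mul_dilate_lt_one hs (hS w (by simp)) hz)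
    obtain ⟨ih1, ih2⟩ := ih fun w' hw' => hS w' (Multiset.mem_cons_of_mem hw')
    have hL : logProd (w ::ₘ S) s z = Complex.log (1 - w * (s * z)) + logProd S s z := by
      simp [logProd]
    have hP : (reciprocalProd (w ::ₘ S)).eval (s * z) =
        (1 - w * (s * z)) * (reciprocalProd S).eval (s * z) := by
      simp [reciprocalProd]
    rw [hL, hP, Complex.add_re, Complex.log_re, ih1, norm_mul,
      log_mul (norm_ne_zero_iff.mpr hw) (norm_ne_zero_iff.mpr ih2)]
    exact ⟨rfl, mul_ne_zero hw ih2⟩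

/-- The Möbius map `u ↦ -u / (1 - u)` sends the unit disc to the half-plane `Re < 1/2`. -/
lemma re_neg_div_one_sub_le {u : ℂ} (hu : ‖u‖ < 1) : (-u / (1 - u)).re ≤ 1 / 2 := by
  have hne := one_sub_mul_ne_zero_of_norm_lt hu
  have hpos : 0 < Complex.normSq (1 - u) := Complex.normSq_pos.mpr hne
  have hsq : u.re * u.re + u.im * u.im < 1 := by
    rw [← Complex.normSq_apply, ← Complex.sq_norm]
    nlinarith [norm_nonneg u]
  rw [Complex.div_re, ← add_div, div_le_iff₀ hpos, Complex.normSq_apply]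
  simp
  nlinarith

open Classical in
lemma re_sum_logDeriv_le {S : Multiset ℂ} (hS : ∀ w ∈ S, ‖w‖ ≤ 1) {s ρ : ℝ} (hs : 0 < s)
    (hs1 : s < 1) (h0 : 0 < ρ) (h1 : ρ < 1) :
    ((ρ : ℂ) * (S.map fun w : ℂ => -(w * s) / (1 - w * (s * ρ))).sum).re ≤
      S.card / 2 - S.count 1 / 2 * ((1 + s * ρ) / (1 - s * ρ)) := by
  induction S using Multiset.induction with
  | empty => simp
  | cons w S ih =>
    have ih := ih fun w' hw' => hS w' (Multiset.mem_cons_of_mem hw')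
    have hsρ : s * ρ < 1 := by nlinarith
    have heq : (ρ : ℂ) * (-(w * s) / (1 - w * (s * ρ))) =
        -(w * (s * ρ)) / (1 - w * (s * ρ)) := by ring
    rw [Multiset.map_cons, Multiset.sum_cons, mul_add, Complex.add_re, heq, Multiset.card_cons]
    by_cases hw : w = 1
    · subst hw
      have : (-(1 * ((s : ℂ) * ρ)) / (1 - 1 * (s * ρ))).re = 1 / 2
          - 1 / 2 * ((1 + s * ρ) / (1 - s * ρ)) := by
        rw [show (-(1 * ((s : ℂ) * ρ)) / (1 - 1 * (s * ρ))) =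
          ((-(s * ρ) / (1 - s * ρ) : ℝ) : ℂ) by push_cast; ring, Complex.ofReal_re]
        have : 1 - s * ρ ≠ 0 := by linarith
        field_simp
        ring
      rw [this, Multiset.count_cons_self]
      push_cast
      linarith
    · rw [Multiset.count_cons_of_ne (Ne.symm hw)]
      have hu : ‖w * (s * ρ)‖ < 1 := by
        refine norm_mul_dilate_lt_one hs (hS w (by simp)) ?_
        rw [mem_ball_zero_iff, Complex.norm_real, norm_of_nonneg h0.le]
        exact h1.trans ((one_lt_inv₀ hs).mpr hs1)
      have := re_neg_div_one_sub_le hu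
      push_cast
      linarith

/-! ### Bounding the multiplicity of `1` by the mean of `log⁺`. -/

open Classical in
-- The dilation `s < 1` makes the logarithm holomorphic across the unit circle, even when zeros of
-- the product lie on it.
lemma count_one_le_circleAverage_dilate {S : Multiset ℂ} (hS : ∀ w ∈ S, ‖w‖ ≤ 1) {s ρ : ℝ}
    (hs : 0 < s) (hs1 : s < 1) (h0 : 0 < ρ) (h1 : ρ < 1) :
    S.count 1 / 2 * ((1 + s * ρ) / (1 - s * ρ)) - S.card / 2 ≤
      9 / 16 * ((1 + ρ) / (1 - ρ)) ^ 2 *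
        circleAverage (fun z => log⁺ ‖(reciprocalProd S).eval z‖) 0 s := by
  have hR : 1 < s⁻¹ := (one_lt_inv₀ hs).mpr hs1
  have hsub : sphere (0 : ℂ) 1 ⊆ ball 0 s⁻¹ :=
    sphere_subset_closedBall.trans (closedBall_subset_ball hR)
  set F := logProd S s with hF
  set U := 2 * ρ / (1 - ρ) ^ 2 with hU
  set M := 9 / 16 * ((1 + ρ) / (1 - ρ)) ^ 2 with hM
  have hFd : DifferentiableOn ℂ F (ball 0 s⁻¹) := fun z hz =>
    (hasDerivAt_logProd hS hs hz).differentiableAt.differentiableWithinAt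
  have hF0 : F 0 = 0 := by simp [hF, logProd]
  have hFc : ContinuousOn (fun z => (F z).re) (sphere 0 1) :=
    Complex.continuous_re.comp_continuousOn (hFd.continuousOn.mono hsub)
  have hρ : (ρ : ℂ) ∈ ball (0 : ℂ) s⁻¹ := by
    rw [mem_ball_zero_iff, Complex.norm_real, norm_of_nonneg h0.le]
    exact h1.trans hR
  -- Mean zero allows the kernel to be shifted by the constant `U`, making the weight `U - k`
  -- nonnegative.
  have hmean : circleAverage (fun z => (F z).re) 0 1 = 0 := by
    have hd : DiffContOnCl ℂ F (ball 0 |1|) := by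
      rw [abs_one]
      exact hFd.diffContOnCl_ball (closedBall_subset_ball hR)
    have hi : CircleIntegrable F 0 1 :=
      (hFd.continuousOn.mono hsub).circleIntegrable zero_le_one
    have := ContinuousLinearMap.circleAverage_comp_comm Complex.reCLM hi
    rw [hd.circleAverage, hF0, map_zero] at this
    exact this
  have hkc : ContinuousOn (poissonRadialDeriv ρ) (sphere 0 1) :=
    continuousOn_const.mul (Complex.continuous_re.comp_continuousOn
      ((differentiableOn_koebe h0 h1).continuousOn.mono sphere_subset_closedBall))
  have hder : circleAverage (fun z => (F z).re * poissonRadialDeriv ρ z) 0 1 ≤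
      S.card / 2 - S.count 1 / 2 * ((1 + s * ρ) / (1 - s * ρ)) := by
    rw [circleAverage_re_mul_poissonRadialDeriv hR hFd hF0 h0 h1,
      (hasDerivAt_logProd hS hs hρ).deriv]
    exact re_sum_logDeriv_le hS hs hs1 h0 h1
  have hi1 : CircleIntegrable (fun z => U * (F z).re) 0 1 :=
    (continuousOn_const.mul hFc).circleIntegrable zero_le_one
  have hi2 : CircleIntegrable (fun z => (F z).re * poissonRadialDeriv ρ z) 0 1 :=
    (hFc.mul hkc).circleIntegrable zero_le_one
  have hPc : Continuous (fun z : ℂ => log⁺ ‖(reciprocalProd S).eval z‖) :=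
    continuous_posLog.comp (reciprocalProd S).continuous.norm
  have hPi : CircleIntegrable (fun z => M * log⁺ ‖(reciprocalProd S).eval (s * z)‖) 0 1 :=
    (continuous_const.mul (hPc.comp (continuous_const.mul continuous_id))).continuousOn
      |>.circleIntegrable zero_le_one
  have hmono : circleAverage (fun z => U * (F z).re - (F z).re * poissonRadialDeriv ρ z) 0 1 ≤
      circleAverage (fun z => M * log⁺ ‖(reciprocalProd S).eval (s * z)‖) 0 1 := by
    refine circleAverage_mono (hi1.sub hi2) hPi fun z hz => ?_
    rw [abs_one] at hz
    obtain ⟨hb1, hb2⟩ := poissonRadialDeriv_bounds h0 h1 (mem_sphere_zero_iff_norm.mp hz)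
    have hlog : (F z).re ≤ log⁺ ‖(reciprocalProd S).eval (s * z)‖ := by
      rw [hF, (re_logProd hS hs (hsub hz)).1]
      exact le_max_right _ _
    calc U * (F z).re - (F z).re * poissonRadialDeriv ρ z
        = (U - poissonRadialDeriv ρ z) * (F z).re := by ring
      _ ≤ (U - poissonRadialDeriv ρ z) * log⁺ ‖(reciprocalProd S).eval (s * z)‖ :=
        mul_le_mul_of_nonneg_left hlog (by linarith)
      _ ≤ M * log⁺ ‖(reciprocalProd S).eval (s * z)‖ :=
        mul_le_mul_of_nonneg_right (by linarith) posLog_nonneg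
  rw [circleAverage_fun_sub hi1 hi2] at hmono
  have hU0 : circleAverage (fun z => U * (F z).re) 0 1 = 0 := by
    have := circleAverage_fun_smul (a := U) (f := fun z => (F z).re) (c := 0) (R := 1)
    simpa [hmean] using this
  have hM0 : circleAverage (fun z => M * log⁺ ‖(reciprocalProd S).eval (s * z)‖) 0 1 =
      M * circleAverage (fun z => log⁺ ‖(reciprocalProd S).eval z‖) 0 s := by
    rw [circleAverage_eq_circleAverage_zero_one (R := s)]
    have := circleAverage_fun_smul (a := M)
      (f := fun z => log⁺ ‖(reciprocalProd S).eval (s * z)‖) (c := 0) (R := 1)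
    simpa using this
  rw [hU0, hM0] at hmono
  linarith

open Classical in
-- Let `s → 1`: only `log⁺` remains in the inequality, and it stays continuous at the zeros where
-- `log` is singular.
lemma count_one_le_circleAverage {S : Multiset ℂ} (hS : ∀ w ∈ S, ‖w‖ ≤ 1) {ρ : ℝ}
    (h0 : 0 < ρ) (h1 : ρ < 1) :
    S.count 1 / 2 * ((1 + ρ) / (1 - ρ)) - S.card / 2 ≤
      9 / 16 * ((1 + ρ) / (1 - ρ)) ^ 2 *
        circleAverage (fun z => log⁺ ‖(reciprocalProd S).eval z‖) 0 1 := by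
  have hPc : Continuous (fun z : ℂ => log⁺ ‖(reciprocalProd S).eval z‖) :=
    continuous_posLog.comp (reciprocalProd S).continuous.norm
  have hr : Filter.Tendsto (fun s : ℝ => 9 / 16 * ((1 + ρ) / (1 - ρ)) ^ 2 *
      circleAverage (fun z => log⁺ ‖(reciprocalProd S).eval z‖) 0 s) (nhdsWithin 1 (Set.Iio 1))
      (nhds (9 / 16 * ((1 + ρ) / (1 - ρ)) ^ 2 *
        circleAverage (fun z => log⁺ ‖(reciprocalProd S).eval z‖) 0 1)) :=
    ((continuous_const.mul hPc.circleAverage).tendsto 1).mono_left nhdsWithin_le_nhds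
  have hl : Filter.Tendsto (fun s : ℝ => S.count 1 / 2 * ((1 + s * ρ) / (1 - s * ρ))
      - (S.card / 2 : ℝ)) (nhdsWithin 1 (Set.Iio 1))
      (nhds (S.count 1 / 2 * ((1 + 1 * ρ) / (1 - 1 * ρ)) - S.card / 2)) := by
    have hne : 1 - 1 * ρ ≠ 0 := by linarith
    have : ContinuousAt (fun s : ℝ => S.count 1 / 2 * ((1 + s * ρ) / (1 - s * ρ))
      - (S.card / 2 : ℝ)) 1 := by fun_prop (disch := exact hne)
    exact this.tendsto.mono_left nhdsWithin_le_nhds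
  rw [one_mul] at hl
  refine le_of_tendsto_of_tendsto hl hr ?_
  filter_upwards [Ioo_mem_nhdsLT (zero_lt_one' ℝ)] with s hs
  exact count_one_le_circleAverage_dilate hS hs.1 hs.2 h0 h1

open Classical in
lemma sq_count_one_le {S : Multiset ℂ} (hS : ∀ w ∈ S, ‖w‖ ≤ 1) {n : ℝ} (hn : S.card ≤ n) :
    (S.count 1 : ℝ) ^ 2 ≤
      2 * π * n * circleAverage (fun z => log⁺ ‖(reciprocalProd S).eval z‖) 0 1 := by
  set H := circleAverage (fun z => log⁺ ‖(reciprocalProd S).eval z‖) 0 1 with hH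
  have hHn : 0 ≤ H := circleAverage_nonneg_of_nonneg fun _ _ => posLog_nonneg
  have hn0 : 0 ≤ n := (Nat.cast_nonneg _).trans hn
  rcases Nat.eq_zero_or_pos (S.count 1) with hc | hc
  · rw [hc]
    have := pi_pos
    simp only [Nat.cast_zero, ne_eq, OfNat.ofNat_ne_zero, not_false_eq_true, zero_pow]
    positivity
  set r : ℝ := (S.count 1 : ℝ) with hr
  have hr0 : 0 < r := Nat.cast_pos.mpr hc
  have hrn : r ≤ n := le_trans (Nat.cast_le.mpr (Multiset.count_le_card _ _)) hn
  have hsum : 0 < 2 * n + r := by linarith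
  -- This `ρ` solves `(1 + ρ)/(1 - ρ) = 2n/r`, which maximizes `(r A - n) / A²`.
  have hA : (1 + (2 * n - r) / (2 * n + r)) / (1 - (2 * n - r) / (2 * n + r)) = 2 * n / r := by
    have : 1 - (2 * n - r) / (2 * n + r) = 2 * r / (2 * n + r) := by field_simp; ring
    rw [this]
    field_simp
    ring
  have key := count_one_le_circleAverage hS (ρ := (2 * n - r) / (2 * n + r))
    (by apply div_pos <;> linarith) (by rw [div_lt_one hsum]; linarith)
  rw [hA, ← hH, ← hr] at key
  have h1 : r / 2 * (2 * n / r) = n := by field_simp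
  rw [h1] at key
  have h2 : n / 2 ≤ 9 / 4 * n ^ 2 / r ^ 2 * H := by
    calc n / 2 ≤ n - S.card / 2 := by linarith
      _ ≤ _ := key
      _ = _ := by ring
  have hnpos : 0 < n := hr0.trans_le hrn
  have h3 : n * r ^ 2 ≤ n * (9 / 2 * n * H) := by
    have := mul_le_mul_of_nonneg_right h2 (by positivity : 0 ≤ 2 * r ^ 2)
    calc n * r ^ 2 = n / 2 * (2 * r ^ 2) := by ring
      _ ≤ _ := this
      _ = _ := by field_simp; ring
  have h4 := le_of_mul_le_mul_left h3 hnpos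
  -- The slack is ample: `9/2 < 6 < 2π`.
  have h5 : 9 / 2 * (n * H) ≤ 2 * π * (n * H) :=
    mul_le_mul_of_nonneg_right (by linarith [pi_gt_three]) (by positivity)
  linarith

/-! ### From normalized roots to the radial polynomial. -/

/-- For points of modulus `0` or `1`, `|z - b| = |1 - b̄ z|` on the unit circle. -/
lemma norm_eval_prod_X_sub_C {S : Multiset ℂ} (hS : ∀ b ∈ S, b = 0 ∨ ‖b‖ = 1) {z : ℂ}
    (hz : ‖z‖ = 1) :
    ‖((S.map fun b => Polynomial.X - Polynomial.C b).prod).eval z‖ =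
      ‖(reciprocalProd (S.map (starRingEnd ℂ))).eval z‖ := by
  induction S using Multiset.induction with
  | empty => simp [reciprocalProd]
  | cons b S ih =>
    have ih := ih fun b' hb' => hS b' (Multiset.mem_cons_of_mem hb')
    have hb : ‖z - b‖ = ‖1 - (starRingEnd ℂ) b * z‖ := by
      rcases hS b (by simp) with rfl | hb
      · simp [hz]
      · have hbb : (starRingEnd ℂ) b * b = 1 := by
          rw [mul_comm, Complex.mul_conj, Complex.normSq_eq_norm_sq, hb]; simp
        have : 1 - (starRingEnd ℂ) b * z = (starRingEnd ℂ) b * (b - z) := by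
          linear_combination -hbb
        rw [this, norm_mul, RCLike.norm_conj, hb, one_mul, norm_sub_rev]
    simp only [reciprocalProd, Multiset.map_cons, Multiset.prod_cons, Polynomial.eval_mul,
      norm_mul] at ih ⊢
    rw [ih]
    simp [hb]

lemma hTilde_eq_circleAverage (R : Polynomial ℂ) :
    hTilde R = circleAverage (fun z => log⁺ ‖(radial R).eval z‖) 0 1 := by
  simp [hTilde, circleAverage, circleMap]

open Classical in
/-- The angular discrepancy bound for the zero set on a single ray. -/
lemma sq_count_normalized_roots_le (R : Polynomial ℂ) :
    (((R.roots.map fun b => b / (‖b‖ : ℂ)).count 1 : ℕ) : ℝ) ^ 2 ≤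
      2 * π * R.natDegree * hTilde R := by
  set T := R.roots.map fun b => b / (‖b‖ : ℂ) with hT
  -- A root at `0` normalizes to `0 / 0 = 0`; its factor `X` has modulus `1` on the circle and is
  -- harmless.
  have hT1 : ∀ b ∈ T, b = 0 ∨ ‖b‖ = 1 := by
    intro b hb
    obtain ⟨a, -, rfl⟩ := Multiset.mem_map.mp hb
    by_cases ha : a = 0
    · simp [ha]
    · right
      rw [norm_div, Complex.norm_real, norm_norm, div_self (norm_ne_zero_iff.mpr ha)]
  have hS : ∀ w ∈ T.map (starRingEnd ℂ), ‖w‖ ≤ 1 := by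
    intro w hw
    obtain ⟨a, ha, rfl⟩ := Multiset.mem_map.mp hw
    rw [RCLike.norm_conj]
    rcases hT1 a ha with rfl | h
    · simp
    · exact h.le
  have hcard : ((T.map (starRingEnd ℂ)).card : ℝ) ≤ R.natDegree := by
    rw [Multiset.card_map, hT, Multiset.card_map]
    exact_mod_cast R.card_roots'
  have hcount : (T.map (starRingEnd ℂ)).count 1 = T.count 1 := by
    simpa using Multiset.count_map_eq_count' (starRingEnd ℂ) T (starRingEnd ℂ).injective 1
  have hH : hTilde R = circleAverage
      (fun z => log⁺ ‖(reciprocalProd (T.map (starRingEnd ℂ))).eval z‖) 0 1 := by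
    rw [hTilde_eq_circleAverage]
    refine circleAverage_congr_sphere fun z hz => ?_
    rw [abs_one] at hz
    rw [← norm_eval_prod_X_sub_C hT1 (mem_sphere_zero_iff_norm.mp hz), radial, hT,
      Multiset.map_map]
    rfl
  rw [hH, ← hcount]
  exact sq_count_one_le hS hcard

open Classical in
-- Real roots embed into the complex roots with multiplicity, and `x / |x| = 1` for `x > 0`.
lemma rp_le_count_normalized_roots (R : Polynomial ℤ) :
    rp (R.map (Int.castRingHom ℝ)) ≤
      ((R.map (Int.castRingHom ℂ)).roots.map fun b => b / (‖b‖ : ℂ)).count 1 := by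
  have hmap : (R.map (Int.castRingHom ℝ)).map Complex.ofRealHom = R.map (Int.castRingHom ℂ) := by
    rw [Polynomial.map_map]
    congr 1
  have hle := Polynomial.map_roots_le_of_injective (R.map (Int.castRingHom ℝ))
    Complex.ofRealHom.injective
  rw [hmap] at hle
  refine le_trans ?_ (Multiset.count_le_of_le 1 (Multiset.map_le_map hle))
  rw [Multiset.map_map, Multiset.count_map, rp]
  refine Multiset.card_le_card (Multiset.monotone_filter_right _ fun x hx => ?_)
  have hx' : (x : ℂ) ≠ 0 := by exact_mod_cast (ne_of_gt hx)
  simp [abs_of_pos hx, div_self hx']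

/-- Partial sums of an alternating series with decreasing terms bracket its sum: here `1 - 1/9` and
`1`. -/
lemma catalanConstant_bounds : 0 < catalanConstant ∧ catalanConstant ≤ 1 := by
  have hanti : Antitone (fun m : ℕ => 1 / (2 * (m : ℝ) + 1) ^ 2) := by
    intro a b hab
    dsimp only
    gcongr
  have hsum : Summable (fun m : ℕ => (-1 : ℝ) ^ m * (1 / (2 * (m : ℝ) + 1) ^ 2)) := by
    refine Summable.of_norm_bounded
      ((summable_nat_add_iff 1).mpr (summable_one_div_nat_pow.mpr one_lt_two)) fun m => ?_
    rw [norm_mul, norm_pow, norm_neg, norm_one, one_pow, one_mul, norm_of_nonneg (by positivity)]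
    push_cast
    gcongr
    linarith [Nat.cast_nonneg (α := ℝ) m]
  have hk : catalanConstant = ∑' m : ℕ, (-1 : ℝ) ^ m * (1 / (2 * (m : ℝ) + 1) ^ 2) := by
    simp only [catalanConstant, mul_one_div]
  have ht := hsum.hasSum.tendsto_sum_nat
  rw [← hk] at ht
  have hlow := hanti.alternating_series_le_tendsto ht 1
  have hup := hanti.tendsto_le_alternating_series ht 0
  norm_num [Finset.sum_range_succ] at hlow hup
  exact ⟨by linarith, hup⟩

end Parry

theorem mainTheorem8 (β : ℝ) (hβ : Parry.IsParryNumber β) :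
    ((Parry.rp ((Parry.parryPoly β).map (Int.castRingHom ℝ)) : ℝ) /
        ((Parry.parryPoly β).natDegree : ℝ)) ^ 2 ≤
      2 * Real.pi / Parry.catalanConstant *
        Parry.dis ((Parry.parryPoly β).map (Int.castRingHom ℂ)) := by
  set P := Parry.parryPoly β
  set d : ℝ := (P.natDegree : ℝ) with hd
  set r : ℝ := (Parry.rp (P.map (Int.castRingHom ℝ)) : ℝ) with hr
  set h := Parry.hTilde (P.map (Int.castRingHom ℂ)) with hh
  have hdeg : (P.map (Int.castRingHom ℂ)).natDegree = P.natDegree :=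
    Polynomial.natDegree_map_eq_of_injective (RingHom.injective_int _) P
  have hmain : r ^ 2 ≤ 2 * π * d * h := by
    have h1 := Parry.sq_count_normalized_roots_le (P.map (Int.castRingHom ℂ))
    rw [hdeg] at h1
    refine le_trans ?_ h1
    exact pow_le_pow_left₀ (Nat.cast_nonneg _)
      (Nat.cast_le.mpr (Parry.rp_le_count_normalized_roots P)) 2
  obtain ⟨hk0, hk1⟩ := Parry.catalanConstant_bounds
  have hh0 : 0 ≤ h := by
    rw [hh, Parry.hTilde_eq_circleAverage]
    exact circleAverage_nonneg_of_nonneg fun _ _ => posLog_nonneg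
  have hd0 : 0 ≤ d := Nat.cast_nonneg _
  rw [Parry.dis, hdeg, ← hd, ← hh]
  have hπk : 2 * π ≤ 2 * π / Parry.catalanConstant := by
    rw [le_div_iff₀ hk0]
    nlinarith [pi_pos]
  refine le_trans ?_ (mul_le_mul_of_nonneg_right hπk (div_nonneg hh0 hd0))
  -- In degree `0` both sides are `0`, since division by zero gives `0`.
  rcases hd0.eq_or_lt with h0 | h0
  · simp [← h0]
  · rw [div_pow, div_le_iff₀ (by positivity)]
    calc r ^ 2 ≤ 2 * π * d * h := hmain
      _ = 2 * π * (h / d) * d ^ 2 := by field_simp
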